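/- Let $d\ge 2$, let $F_d$ be the free group on $d$ generators, and let $\mu$ be the uniform distribution on the set of the $d$ free generators and their inverses (the step distribution of the simple random walk on $F_d$). Write $\mu^{(n)}$ for the $n$-fold convolution of $\mu$. For a finitely supported probability distribution $\nu$, let $$H_\alpha(\nu)=\frac{1}{1-\alpha}\log\sum_{\omega}\nu(\omega)^\alpha\quad(\alpha\in(0,\infty)\setminus\{1\}),\qquad H_1(\nu)=\sum_\omega \nu(\omega)\log\frac1{\nu(\omega)},\qquad H_\infty(\nu)=-\log\max_\omega\nu(\omega)$$ be its Rényi entropies. Then for every $\alpha\in(0,\infty]$ the limit $$h_\alpha(\mu)=\lim_{n\to\infty}\frac1n H_\alpha(\mu^{(n)})$$ exists and is finite, and the function $\alpha\mapsto h_\alpha(\mu)$ has the following properties. 1. It is real-analytic on $(0,\infty)\setminus\{2\}$ (in particular at $\alpha=1$). 2. It is not analytic at $\alpha=2$: it is differentiable at $2$, but not twice differentiable at $2$. 3. For $\alpha\in(0,2)\setminus\{1\}$, $$h_\alpha(\mu)=\frac{1}{1-\alpha}f_\alpha(p_\alpha^*),\qquad p_\alpha^*=\frac{(2d-1)^{2/\alpha}}{(2d-1)+(2d-1)^{2/\alpha}},$$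 where $$f_\alpha(p)=\alpha\bigl(-\log(2d)-p\log p-(1-p)\log(1-p)+p\log(2d-1)\bigr)+(1-\alpha)(2p-1)\log(2d-1).$$ 4. For $\alpha\in[2,\infty)$, $h_\alpha(\mu)=\dfrac{\alpha}{\alpha-1}\,h_\infty(\mu)$. -/

import Mathlib

open Filter Topology
open scoped ENNReal

noncomputable section

namespace RenyiWalk

/-- The `α`-Rényi entropy, `α ∈ [0, ∞]`, of a (finitely supported) probability distribution `ν`.
For `α = ∞` it is minus the logarithm of the mass of the largest atom. -/
def renyiEntropy {Ω : Type*} (α : ℝ≥0∞) (ν : PMF Ω) : ℝ :=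
  if α = 0 then Real.log (ν.support.ncard : ℝ)
  else if α = 1 then ∑' ω, (ν ω).toReal * Real.log (1 / (ν ω).toReal)
  else if α = ⊤ then -Real.log (⨆ ω, (ν ω).toReal)
  else 1 / (1 - α.toReal) * Real.log (∑' ω, (ν ω).toReal ^ α.toReal)

/-- Convolution: the law of `X * Y` for independent `X ∼ μ`, `Y ∼ ν`. -/
def convolution {G : Type*} [Monoid G] (μ ν : PMF G) : PMF G :=
  μ.bind fun x => ν.map fun y => x * y

/-- The `n`-fold convolution of `μ` with itself, i.e. the law of the `μ`-random walk at time `n`,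
started at the identity. -/
def convPow {G : Type*} [Monoid G] (μ : PMF G) : ℕ → PMF G
  | 0 => PMF.pure 1
  | n + 1 => convolution (convPow μ n) μ

/-- The asymptotic `α`-Rényi entropy `lim (1/n) H_α(μ^{(n)})`. -/
def asymptoticRenyiEntropy {G : Type*} [Monoid G] (α : ℝ≥0∞) (μ : PMF G) : ℝ :=
  limUnder atTop fun n : ℕ => 1 / (n : ℝ) * renyiEntropy α (convPow μ n)

/-- The free generators of `F_d` together with their inverses. -/
def freeSteps (d : ℕ) : Finset (FreeGroup (Fin d)) :=
  (Finset.univ.image fun i : Fin d => FreeGroup.of i) ∪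
    (Finset.univ.image fun i : Fin d => (FreeGroup.of i)⁻¹)

theorem freeSteps_nonempty {d : ℕ} (hd : 2 ≤ d) : (freeSteps d).Nonempty :=
  ⟨FreeGroup.of ⟨0, by omega⟩, by simp [freeSteps]⟩

/-- The step distribution of the simple random walk on `F_d`: the uniform distribution on the
free generators and their inverses. -/
def freeSRW (d : ℕ) (hd : 2 ≤ d) : PMF (FreeGroup (Fin d)) :=
  PMF.uniformOfFinset (freeSteps d) (freeSteps_nonempty hd)

/-- The function `α ↦ h_α(μ)` of a real variable (of interest for `α > 0`), where `μ` is the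
simple random walk on `F_d`. -/
def freeEntropy (d : ℕ) (hd : 2 ≤ d) (α : ℝ) : ℝ :=
  asymptoticRenyiEntropy (ENNReal.ofReal α) (freeSRW d hd)

/-- `f_α(p) = α (-log (2d) + H(p) + p log (2d-1)) + (1-α) (2p-1) log (2d-1)`, where
`H(p) = -p log p - (1-p) log (1-p)` is the binary entropy. -/
def freeRate (d : ℕ) (α p : ℝ) : ℝ :=
  α * (-Real.log (2 * d) + Real.binEntropy p + p * Real.log (2 * d - 1)) +
    (1 - α) * (2 * p - 1) * Real.log (2 * d - 1)

/-- `p*_α = (2d-1)^{2/α} / ((2d-1) + (2d-1)^{2/α})`. -/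
def freeOpt (d : ℕ) (α : ℝ) : ℝ :=
  (2 * d - 1 : ℝ) ^ (2 / α) / ((2 * d - 1) + (2 * d - 1 : ℝ) ^ (2 / α))

end RenyiWalk

end

/-! Write q = 2d - 1. The mass of x at time n depends only on k = |x|, and equals `walkCount d n k`
/ (2d)^n. With n = 2v + k, the count is q^v C(n,v) up to a factor n + 1 (`walkCount_le`,
`le_walkCount`), and the sphere of radius k has q^k elements up to a factor 2. So the sum of α-th
powers is, up to polynomial factors, q^n (2d)^(-αn) max (C(n,v) x^v)^α over v ≤ n/2, with x =
q^((α-2)/α).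

The maximum grows like (1+x)^n if x ≤ 1, when the unconstrained maximizer is admissible, and like
(2√x)^n if x > 1, when v = n/2 is optimal. Since x ≤ 1 exactly when α ≤ 2, this constraint is the
source of the phase transition.

With L = log q and w = L(1/2 - 1/α), one has x = e^(2w) and 1 + x = 2 e^w cosh w. Hence the log-rate
is α log(√q/d), plus the excess α log cosh w only for α ≤ 2 (`log_powerSumRate_of_le_two`,
`log_powerSumRate_of_two_le`). The excess vanishes to exactly second order at 2, so the glued
function has a first derivative there but no second.

At α = 1 Jensen's inequality squeezes the Shannon entropy between difference quotients of the
log-rate (`tendsto_entropy_one`). The limit is the value that removes the singularity of the formula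
at 1, which gives analyticity there. -/

namespace RenyiWalk

/-! ### Letters, spheres and their cardinalities -/

/-- The generator `x_i` (for `(i, true)`) or its inverse (for `(i, false)`). -/
def letter {d : ℕ} (p : Fin d × Bool) : FreeGroup (Fin d) := FreeGroup.mk [p]

theorem letter_injective {d : ℕ} : Function.Injective (letter (d := d)) := by
  intro p p' h
  have := congrArg FreeGroup.toWord h
  simpa [letter, FreeGroup.toWord_mk] using this

theorem letter_inv {d : ℕ} (p : Fin d × Bool) : (letter p)⁻¹ = letter (p.1, !p.2) := by
  simp [letter, FreeGroup.inv_mk, FreeGroup.invRev]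

theorem freeSteps_eq_image (d : ℕ) : freeSteps d = Finset.univ.image letter := by
  ext x
  simp only [freeSteps, Finset.mem_union, Finset.mem_image, Finset.mem_univ, true_and]
  constructor
  · rintro (⟨i, rfl⟩ | ⟨i, rfl⟩)
    · exact ⟨(i, true), rfl⟩
    · exact ⟨(i, false), rfl⟩
  · rintro ⟨⟨i, b⟩, rfl⟩
    cases b
    · exact Or.inr ⟨i, rfl⟩
    · exact Or.inl ⟨i, rfl⟩

theorem card_freeSteps (d : ℕ) : (freeSteps d).card = 2 * d := by
  rw [freeSteps_eq_image, Finset.card_image_of_injective _ letter_injective]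
  simp [mul_comm]

theorem toWord_letter_mul {d : ℕ} (p : Fin d × Bool) (y : FreeGroup (Fin d)) :
    (letter p * y).toWord = FreeGroup.reduce (p :: y.toWord) := by
  rw [FreeGroup.toWord_mul, letter, FreeGroup.toWord_mk, FreeGroup.reduce_singleton]
  rfl

theorem norm_letter {d : ℕ} (p : Fin d × Bool) : (letter p).norm = 1 := by
  rw [FreeGroup.norm, letter, FreeGroup.toWord_mk, FreeGroup.reduce_singleton]
  rfl

/-- Exactly one letter shortens a given nontrivial element; all others lengthen it. -/
theorem exists_norm_letter_mul {d k : ℕ} {y : FreeGroup (Fin d)} (hy : y.norm = k + 1) :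
    ∃ p₀, ∀ p, (letter p * y).norm = if p = p₀ then k else k + 2 := by
  rcases h : y.toWord with _ | ⟨a, l⟩
  · simp [FreeGroup.norm, h] at hy
  · have hl : l.length = k := by simpa [FreeGroup.norm, h] using hy
    have hr : FreeGroup.reduce (a :: l) = a :: l := by rw [← h, FreeGroup.reduce_toWord]
    refine ⟨(a.1, !a.2), fun p => ?_⟩
    rw [FreeGroup.norm, toWord_letter_mul, h, FreeGroup.reduce.cons, hr]
    by_cases hp : p.1 = a.1 ∧ p.2 = !a.2
    · have : p = (a.1, !a.2) := Prod.ext hp.1 hp.2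
      simp [this, hl]
    · have : p ≠ (a.1, !a.2) := fun e => hp (by simp [e])
      simp [hp, this, hl]

theorem sum_norm_letter_mul {d k : ℕ} {M : Type*} [AddCommMonoid M] {y : FreeGroup (Fin d)}
    (hy : y.norm = k + 1) (F : ℕ → M) :
    ∑ p, F (letter p * y).norm = F k + (2 * d - 1) • F (k + 2) := by
  obtain ⟨p₀, hp₀⟩ := exists_norm_letter_mul hy
  rw [← Finset.add_sum_erase _ _ (Finset.mem_univ p₀), hp₀, if_pos rfl,
    Finset.sum_congr rfl fun p hp => by rw [hp₀, if_neg (Finset.ne_of_mem_erase hp)],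
    Finset.sum_const, Finset.card_erase_of_mem (Finset.mem_univ _)]
  simp [mul_comm]

theorem finite_norm_eq (d k : ℕ) : {x : FreeGroup (Fin d) | x.norm = k}.Finite :=
  (List.finite_length_eq (Fin d × Bool) k).preimage FreeGroup.toWord_injective.injOn

/-- The sphere of radius `k` in the free group. -/
noncomputable def sphere (d k : ℕ) : Finset (FreeGroup (Fin d)) := (finite_norm_eq d k).toFinset

@[simp] theorem mem_sphere {d k : ℕ} {x : FreeGroup (Fin d)} : x ∈ sphere d k ↔ x.norm = k := by
  simp [sphere]

theorem card_sphere_zero (d : ℕ) : (sphere d 0).card = 1 := by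
  rw [Finset.card_eq_one]
  exact ⟨1, by ext; simp⟩

theorem card_letters_norm_eq {d j : ℕ} (y : FreeGroup (Fin d)) [∀ x : FreeGroup (Fin d),
    Decidable (∃ p, x = letter p * y)] :
    ((sphere d j).filter fun x => ∃ p, x = letter p * y).card =
      ∑ p : Fin d × Bool, if (letter p * y).norm = j then 1 else 0 := by
  rw [← Finset.card_filter, ← Finset.card_image_of_injective _
    ((mul_left_injective y).comp letter_injective)]
  congr 1
  ext x
  simp only [Finset.mem_filter, mem_sphere, Finset.mem_image, Finset.mem_univ, true_and,
    Function.comp]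
  constructor
  · rintro ⟨hx, p, rfl⟩
    exact ⟨p, hx, rfl⟩
  · rintro ⟨p, hx, rfl⟩
    exact ⟨hx, p, rfl⟩

/-- Double counting of the Cayley graph edges between consecutive spheres: each element of the outer
sphere has exactly one neighbour in the inner one. -/
theorem card_sphere_mul {d k m : ℕ}
    (hm : ∀ y : FreeGroup (Fin d), y.norm = k →
      (∑ p : Fin d × Bool, if (letter p * y).norm = k + 1 then 1 else 0) = m) :
    (sphere d k).card * m = (sphere d (k + 1)).card := by
  classical
  have key := Finset.card_mul_eq_card_mul (s := sphere d k) (t := sphere d (k + 1)) (m := m) (n := 1)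
    (fun y x => ∃ p, x = letter p * y)
    (fun y hy => by
      rw [Finset.bipartiteAbove, card_letters_norm_eq]
      exact hm y (mem_sphere.1 hy))
    (fun x hx => by
      have : ∀ y : FreeGroup (Fin d), (∃ p, x = letter p * y) ↔ ∃ p, y = letter p * x := by
        intro y
        constructor <;>
        · rintro ⟨p, rfl⟩
          exact ⟨(p.1, !p.2), by rw [← letter_inv]; simp⟩
      simp only [Finset.bipartiteBelow, this]
      rw [card_letters_norm_eq, sum_norm_letter_mul (mem_sphere.1 hx) fun j => if j = k then 1 else 0]
      simp)
  simpa using key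

theorem card_sphere_succ (d k : ℕ) : (sphere d (k + 1)).card = 2 * d * (2 * d - 1) ^ k := by
  induction k with
  | zero =>
    rw [← card_sphere_mul (m := 2 * d), card_sphere_zero]
    · simp
    · intro y hy
      rw [FreeGroup.norm_eq_zero.1 hy]
      simp [norm_letter, mul_comm]
  | succ k ih =>
    rw [← card_sphere_mul (m := 2 * d - 1), ih]
    · ring
    · intro y hy
      rw [sum_norm_letter_mul hy fun j => if j = k + 1 + 1 then 1 else 0]
      simp [show k ≠ k + 1 + 1 by omega]

theorem pow_le_card_sphere {d : ℕ} (hd : 2 ≤ d) (k : ℕ) : (2 * d - 1) ^ k ≤ (sphere d k).card := by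
  cases k with
  | zero => simp [card_sphere_zero]
  | succ k =>
    rw [card_sphere_succ, pow_succ']
    exact Nat.mul_le_mul_right _ (by omega)

theorem card_sphere_le {d : ℕ} (hd : 2 ≤ d) (k : ℕ) :
    (sphere d k).card ≤ 2 * (2 * d - 1) ^ k := by
  cases k with
  | zero => simp [card_sphere_zero]
  | succ k =>
    rw [card_sphere_succ, pow_succ', ← mul_assoc]
    exact Nat.mul_le_mul_right _ (by omega)

/-! ### The law of the walk in terms of word counts -/

/-- The number of words of length `n` in the letters that represent a given element of norm `k`. -/
def walkCount (d : ℕ) : ℕ → ℕ → ℕ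
  | 0, k => if k = 0 then 1 else 0
  | n + 1, 0 => 2 * d * walkCount d n 1
  | n + 1, k + 1 => walkCount d n k + (2 * d - 1) * walkCount d n (k + 2)

theorem sum_walkCount_letter_mul {d n : ℕ} (y : FreeGroup (Fin d)) :
    ∑ p, walkCount d n (letter p * y).norm = walkCount d (n + 1) y.norm := by
  rcases h : y.norm with _ | k
  · rw [FreeGroup.norm_eq_zero.1 h]
    simp [norm_letter, walkCount, mul_comm]
  · rw [sum_norm_letter_mul h, walkCount, smul_eq_mul]

theorem convolution_uniformOfFinset_apply {G : Type*} [Group G] (μ : PMF G) (s : Finset G)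
    (hs : s.Nonempty) (z : G) :
    convolution μ (PMF.uniformOfFinset s hs) z = ∑ y ∈ s, (s.card : ℝ≥0∞)⁻¹ * μ (z * y⁻¹) := by
  classical
  have h : convolution μ (PMF.uniformOfFinset s hs) =
      (PMF.uniformOfFinset s hs).bind fun y => μ.map fun x => x * y := by
    simp only [convolution, ← PMF.bind_pure_comp]
    -- Sampling the last step first makes the outer sum range over the finite set `s`.
    exact PMF.bind_comm _ _ _
  have hmap : ∀ y, (μ.map fun x => x * y) z = μ (z * y⁻¹) := by
    intro y
    rw [PMF.map_apply, tsum_eq_single (z * y⁻¹)]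
    · simp
    · intro x hx
      rw [if_neg]
      rintro rfl
      simp at hx
  rw [h, PMF.bind_apply, tsum_eq_sum (s := s)]
  · refine Finset.sum_congr rfl fun y hy => ?_
    rw [hmap, PMF.uniformOfFinset_apply_of_mem hs hy]
  · intro y hy
    rw [PMF.uniformOfFinset_apply_of_notMem hs hy, zero_mul]

theorem convPow_freeSRW_apply {d : ℕ} (hd : 2 ≤ d) (n : ℕ) (x : FreeGroup (Fin d)) :
    convPow (freeSRW d hd) n x = walkCount d n x.norm * ((2 * d : ℕ) : ℝ≥0∞)⁻¹ ^ n := by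
  induction n generalizing x with
  | zero =>
    by_cases hx : x = 1
    · simp [convPow, walkCount, hx]
    · simp [convPow, walkCount, hx, PMF.pure_apply]
  | succ n ih =>
    -- The walk multiplies on the right, the norm lemmas on the left; inversion preserves the norm
    -- and swaps the sides.
    have hn : ∀ p : Fin d × Bool, (x * (letter p)⁻¹).norm = (letter p * x⁻¹).norm := by
      intro p
      rw [← FreeGroup.norm_inv_eq]
      simp
    have hstep : convPow (freeSRW d hd) (n + 1) x = ∑ y ∈ freeSteps d,
        ((2 * d : ℕ) : ℝ≥0∞)⁻¹ * convPow (freeSRW d hd) n (x * y⁻¹) := by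
      rw [← card_freeSteps]
      exact convolution_uniformOfFinset_apply _ _ _ _
    rw [hstep, freeSteps_eq_image, Finset.sum_image letter_injective.injOn,
      ← FreeGroup.norm_inv_eq (x := x), ← sum_walkCount_letter_mul]
    simp_rw [ih, hn]
    push_cast
    rw [Finset.sum_mul]
    refine Finset.sum_congr rfl fun p _ => ?_
    ring

theorem toReal_convPow_freeSRW {d : ℕ} (hd : 2 ≤ d) (n : ℕ) (x : FreeGroup (Fin d)) :
    (convPow (freeSRW d hd) n x).toReal = walkCount d n x.norm / (2 * d : ℝ) ^ n := by
  rw [convPow_freeSRW_apply, ENNReal.toReal_mul, ENNReal.toReal_pow, ENNReal.toReal_inv,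
    ENNReal.toReal_natCast, ENNReal.toReal_natCast, div_eq_mul_inv, inv_pow]
  push_cast
  rfl

/-! ### Support, parity and ballot bounds for word counts -/

theorem walkCount_eq_zero {d n k : ℕ} (h : n < k) : walkCount d n k = 0 := by
  induction n generalizing k with
  | zero => simp [walkCount]; omega
  | succ n ih =>
    obtain ⟨k, rfl⟩ : ∃ j, k = j + 1 := ⟨k - 1, by omega⟩
    rw [walkCount, ih (by omega), ih (by omega)]
    simp

theorem walkCount_eq_zero_of_odd {d n k : ℕ} (h : Odd (n + k)) : walkCount d n k = 0 := by
  induction n generalizing k with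
  | zero =>
    have : k ≠ 0 := by rintro rfl; simp at h
    simp [walkCount, this]
  | succ n ih =>
    cases k with
    | zero => rw [walkCount, ih (by simpa using h), mul_zero]
    | succ k =>
      have h1 : Odd (n + k) := by
        rw [show n + 1 + (k + 1) = n + k + 2 by ring] at h
        exact (Nat.odd_add.1 h).2 (by decide)
      rw [walkCount, ih h1, ih (by rw [← add_assoc]; exact h1.add_even (by decide)), mul_zero, add_zero]

/-- By Pascal's rule q^v C(n,v) satisfies the recursion exactly for k ≥ 1. At k = 0 the two central
binomials coincide, and 2d ≤ 2q suffices. -/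
theorem walkCount_le {d : ℕ} (hd : 2 ≤ d) {n v k : ℕ} (h : n = 2 * v + k) :
    walkCount d n k ≤ (2 * d - 1) ^ v * n.choose v := by
  induction n generalizing v k with
  | zero => simp [walkCount, show v = 0 by omega, show k = 0 by omega]
  | succ n ih =>
    cases k with
    | zero =>
      obtain ⟨v, rfl⟩ : ∃ j, v = j + 1 := ⟨v - 1, by omega⟩
      have hn : n = 2 * v + 1 := by omega
      have hc : n.choose (v + 1) = n.choose v := by
        rw [hn, Nat.choose_symm_half]
      rw [walkCount, Nat.choose_succ_succ, hc]
      calc 2 * d * walkCount d n 1 ≤ (2 * (2 * d - 1)) * ((2 * d - 1) ^ v * n.choose v) :=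
            Nat.mul_le_mul (by omega) (ih hn)
        _ = _ := by ring
    | succ k =>
      rw [walkCount]
      cases v with
      | zero =>
        rw [walkCount_eq_zero (k := k + 2) (by omega)]
        simpa using ih (v := 0) (k := k) (by omega)
      | succ v =>
        rw [Nat.choose_succ_succ]
        calc _ ≤ (2 * d - 1) ^ (v + 1) * n.choose (v + 1) +
              (2 * d - 1) * ((2 * d - 1) ^ v * n.choose v) :=
              add_le_add (ih (by omega)) (Nat.mul_le_mul_left _ (ih (by omega)))
          _ = _ := by ring

theorem walkCount_self (d n : ℕ) : walkCount d n n = 1 := by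
  induction n with
  | zero => simp [walkCount]
  | succ n ih => rw [walkCount, ih, walkCount_eq_zero (by omega), mul_zero, add_zero]

/-- A ballot-type lower bound for the number of words. -/
theorem ballot_le_walkCount {d : ℕ} (hd : 2 ≤ d) {n v k : ℕ} (h : n + 1 = 2 * (v + 1) + k) :
    (2 * d - 1) ^ (v + 1) * (n + 1).choose (v + 1) ≤
      walkCount d (n + 1) k + (2 * d - 1) ^ (v + 1) * (n + 1).choose v := by
  obtain ⟨q, hq⟩ : ∃ q, 2 * d = q + 1 := ⟨2 * d - 1, by omega⟩
  have hq' : 2 * d - 1 = q := by omega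
  rw [hq']
  induction n generalizing v k with
  | zero => omega
  | succ n ih =>
    cases k with
    | zero =>
      rw [walkCount, hq]
      cases v with
      | zero =>
        obtain rfl : n = 0 := by omega
        simp only [walkCount_self]
        simp
        omega
      | succ v =>
        have hn : n + 1 = 2 * (v + 1) + 1 := by omega
        have hc : (n + 1).choose (v + 1 + 1) = (n + 1).choose (v + 1) := by
          rw [hn, Nat.choose_symm_half]
        -- At the root 2d = q + 1: the q copies are handled by the induction hypothesis, and the
        -- remaining copy of the count is slack.
        have h2 := Nat.mul_le_mul_left q (ih hn)
        rw [Nat.choose_succ_succ' (n + 1) (v + 1), Nat.choose_succ_succ' (n + 1) v, hc]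
        generalize walkCount d (n + 1) 1 = w at *
        generalize (n + 1).choose (v + 1) = c at *
        generalize (n + 1).choose v = c' at *
        ring_nf at h2 ⊢
        linarith [Nat.zero_le w]
    | succ k =>
      rw [walkCount, hq']
      cases v with
      | zero =>
        have h1 := ih (v := 0) (k := k) (by omega)
        obtain rfl : n = k + 1 := by omega
        rw [show walkCount d (k + 1 + 1) (k + 2) = 1 from walkCount_self d (k + 2)]
        simp only [zero_add, pow_one, Nat.choose_one_right, Nat.choose_zero_right] at h1 ⊢
        linarith
      | succ v =>
        have h1 := ih (v := v + 1) (k := k) (by omega)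
        have h2 := Nat.mul_le_mul_left q (ih (v := v) (k := k + 2) (by omega))
        rw [Nat.choose_succ_succ' (n + 1) (v + 1), Nat.choose_succ_succ' (n + 1) v]
        generalize walkCount d (n + 1) k = w at *
        generalize walkCount d (n + 1) (k + 2) = w' at *
        generalize (n + 1).choose (v + 1 + 1) = c₂ at *
        generalize (n + 1).choose (v + 1) = c₁ at *
        generalize (n + 1).choose v = c₀ at *
        ring_nf at h1 h2 ⊢
        linarith

/-- For v ≥ 1 the ballot difference C(n,v) - C(n,v-1) equals C(n,v)(k+1)/(n-v+1), which loses at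
most a factor n + 1. -/
theorem le_walkCount {d : ℕ} (hd : 2 ≤ d) {n v k : ℕ} (h : n = 2 * v + k) :
    (2 * d - 1) ^ v * n.choose v ≤ (n + 1) * walkCount d n k := by
  cases v with
  | zero =>
    obtain rfl : n = k := by omega
    simp [walkCount_self]
  | succ v =>
    obtain ⟨n, rfl⟩ : ∃ m, n = m + 1 := ⟨n - 1, by omega⟩
    have h1 := Nat.mul_le_mul_right (v + 2 + k) (ballot_le_walkCount hd h)
    have h2 := Nat.choose_succ_right_eq (n + 1) v
    rw [show n + 1 - v = v + 2 + k by omega] at h2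
    rw [add_mul, mul_assoc _ ((n + 1).choose v), ← h2] at h1
    have h3 : walkCount d (n + 1) k * (v + 2 + k) ≤ (n + 1 + 1) * walkCount d (n + 1) k := by
      rw [mul_comm]
      exact Nat.mul_le_mul_right _ (by omega)
    refine le_trans ?_ h3
    generalize (2 * d - 1) ^ (v + 1) = Q at *
    generalize (n + 1).choose (v + 1) = c at *
    nlinarith [Nat.zero_le (Q * c * k)]

/-! ### Exponential rates and constrained binomial maxima -/

theorem tendsto_log_add_one_div : Tendsto (fun n : ℕ => Real.log (n + 1) / n) atTop (𝓝 0) := by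
  have h1 : Tendsto (fun n : ℕ => Real.log ((n + 1 : ℕ) : ℝ) / ((n + 1 : ℕ) : ℝ)) atTop (𝓝 0) :=
    (Real.isLittleO_log_id_atTop.tendsto_div_nhds_zero.comp tendsto_natCast_atTop_atTop).comp
      (tendsto_add_atTop_nat 1)
  have h2 : Tendsto (fun n : ℕ => 1 + 1 / (n : ℝ)) atTop (𝓝 (1 + 0)) :=
    tendsto_const_nhds.add tendsto_one_div_atTop_nhds_zero_nat
  have h3 := h1.mul h2
  rw [zero_mul] at h3
  refine h3.congr' ?_
  filter_upwards [eventually_gt_atTop 0] with n hn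
  have : (n : ℝ) ≠ 0 := by positivity
  push_cast
  field_simp

/-- A sequence that agrees with `ρ ^ n` up to polynomial factors has exponential rate `log ρ`. -/
theorem tendsto_log_div_of_le_mul_pow {Z : ℕ → ℝ} {ρ C s : ℝ} (hρ : 0 < ρ) (hC : 0 < C)
    (h₁ : ∀ n : ℕ, Z n ≤ C * ((n : ℝ) + 1) ^ s * ρ ^ n)
    (h₂ : ∀ n : ℕ, ρ ^ n ≤ C * ((n : ℝ) + 1) ^ s * Z n) :
    Tendsto (fun n : ℕ => 1 / (n : ℝ) * Real.log (Z n)) atTop (𝓝 (Real.log ρ)) := by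
  have he : Tendsto (fun n : ℕ => Real.log C * (1 / (n : ℝ)) + s * (Real.log (n + 1) / n)) atTop
      (𝓝 (Real.log C * 0 + s * 0)) :=
    (tendsto_one_div_atTop_nhds_zero_nat.const_mul _).add (tendsto_log_add_one_div.const_mul _)
  simp only [mul_zero, add_zero] at he
  rw [tendsto_iff_norm_sub_tendsto_zero]
  refine tendsto_of_tendsto_of_tendsto_of_le_of_le' tendsto_const_nhds he
    (Eventually.of_forall fun n => norm_nonneg _) ?_
  filter_upwards [eventually_gt_atTop 0] with n hn
  have hn' : (0 : ℝ) < n := by exact_mod_cast hn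
  have hp : 0 < C * ((n : ℝ) + 1) ^ s := by positivity
  have hρn : 0 < ρ ^ n := by positivity
  have hZ : 0 < Z n := pos_of_mul_pos_right (hρn.trans_le (h₂ n)) hp.le
  have hlog : Real.log (C * ((n : ℝ) + 1) ^ s) = Real.log C + s * Real.log (n + 1) := by
    rw [Real.log_mul hC.ne' (by positivity), Real.log_rpow (by positivity)]
  have l₁ := Real.log_le_log hZ (h₁ n)
  have l₂ := Real.log_le_log hρn (h₂ n)
  rw [Real.log_mul hp.ne' hρn.ne', hlog, Real.log_pow] at l₁
  rw [Real.log_mul hp.ne' hZ.ne', hlog, Real.log_pow] at l₂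
  rw [Real.norm_eq_abs,
    show 1 / (n : ℝ) * Real.log (Z n) - Real.log ρ = (Real.log (Z n) - n * Real.log ρ) / n by
      field_simp,
    show Real.log C * (1 / (n : ℝ)) + s * (Real.log (n + 1) / n) =
      (Real.log C + s * Real.log (n + 1)) / n by field_simp,
    abs_div, abs_of_pos hn']
  gcongr
  rw [abs_le]
  constructor <;> linarith

/-- The exponential growth rate of `max_{v ≤ n/2} (n choose v) x ^ v`. -/
noncomputable def growth (x : ℝ) : ℝ := if x ≤ 1 then 1 + x else 2 * √x

theorem growth_pos {x : ℝ} (hx : 0 < x) : 0 < growth x := by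
  unfold growth
  split_ifs <;> positivity

/-- For x ≤ 1 this is a single term of the binomial theorem. For x > 1, C(n,v) ≤ 2^n, and 2v ≤ n
gives x^v ≤ √x^n. -/
theorem choose_mul_pow_le_growth {x : ℝ} (hx : 0 < x) {n v : ℕ} (hv : 2 * v ≤ n) :
    n.choose v * x ^ v ≤ growth x ^ n := by
  unfold growth
  split_ifs with h
  · rw [add_comm 1 x, add_pow]
    calc (n.choose v : ℝ) * x ^ v = x ^ v * 1 ^ (n - v) * n.choose v := by rw [one_pow]; ring
      _ ≤ _ := Finset.single_le_sum (f := fun m => x ^ m * 1 ^ (n - m) * (n.choose m : ℝ))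
          (fun m _ => by positivity) (Finset.mem_range.2 (by omega))
  · have h1 : 1 ≤ √x := by
      rw [Real.one_le_sqrt]
      linarith
    have h2 : (n.choose v : ℝ) ≤ 2 ^ n := by exact_mod_cast Nat.choose_le_two_pow n v
    have h3 : x ^ v = √x ^ (2 * v) := by rw [pow_mul, Real.sq_sqrt hx.le]
    rw [mul_pow, h3]
    gcongr

/-- For x ≤ 1 some term of (1+x)^n is at least the average, and if its index exceeds n/2, reflecting
m to n - m only enlarges it. For x > 1 the central term works; the factor 1 + √x absorbs the odd
step. -/
theorem exists_growth_pow_le {x : ℝ} (hx : 0 < x) (n : ℕ) :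
    ∃ v, 2 * v ≤ n ∧ growth x ^ n ≤ (1 + √x) * (n + 1) * (n.choose v * x ^ v) := by
  have hs := Real.sqrt_nonneg x
  unfold growth
  split_ifs with h
  · obtain ⟨m, hm, hle⟩ : ∃ m ∈ Finset.range (n + 1),
        (1 + x) ^ n ≤ (n + 1) * (n.choose m * x ^ m) := by
      by_contra! hc
      have h1 : ∑ m ∈ Finset.range (n + 1), ((n : ℝ) + 1) * (n.choose m * x ^ m) <
          ∑ m ∈ Finset.range (n + 1), (1 + x) ^ n :=
        Finset.sum_lt_sum_of_nonempty ⟨0, by simp⟩ hc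
      have h2 : ∑ m ∈ Finset.range (n + 1), ((n.choose m : ℝ) * x ^ m) = (1 + x) ^ n := by
        rw [add_comm 1 x, add_pow]
        exact Finset.sum_congr rfl fun m _ => by rw [one_pow]; ring
      rw [← Finset.mul_sum, h2] at h1
      simp at h1
    have hmn : m ≤ n := by simpa [Nat.lt_succ_iff] using hm
    have key : ∃ v, 2 * v ≤ n ∧ (n.choose m * x ^ m : ℝ) ≤ n.choose v * x ^ v := by
      by_cases hv : 2 * m ≤ n
      · exact ⟨m, hv, le_rfl⟩
      · refine ⟨n - m, by omega, ?_⟩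
        rw [Nat.choose_symm hmn]
        gcongr ?_ * ?_
        exact pow_le_pow_of_le_one hx.le h (by omega)
    obtain ⟨v, hv, hmv⟩ := key
    refine ⟨v, hv, hle.trans ?_⟩
    have : 0 ≤ ((n : ℝ) + 1) * (n.choose v * x ^ v) := by positivity
    have h3 : ((n : ℝ) + 1) * (n.choose m * x ^ m) ≤ (n + 1) * (n.choose v * x ^ v) := by gcongr
    nlinarith
  · have h1 : 1 ≤ √x := by
      rw [Real.one_le_sqrt]
      linarith
    refine ⟨n / 2, by omega, ?_⟩
    have h2 : (2 : ℝ) ^ n ≤ (n + 1) * n.choose (n / 2) := by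
      have : 2 ^ n ≤ (n + 1) * n.choose (n / 2) := by
        rw [← Nat.sum_range_choose]
        calc _ ≤ ∑ m ∈ Finset.range (n + 1), n.choose (n / 2) :=
              Finset.sum_le_sum fun m _ => Nat.choose_le_middle m n
          _ = _ := by simp
      exact_mod_cast this
    have h3 : √x ^ n ≤ (1 + √x) * x ^ (n / 2) := by
      calc √x ^ n ≤ √x ^ (2 * (n / 2) + 1) := pow_le_pow_right₀ h1 (by omega)
        _ = √x * x ^ (n / 2) := by rw [pow_succ, pow_mul, Real.sq_sqrt hx.le, mul_comm]
        _ ≤ _ := by gcongr; linarith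
    calc (2 * √x) ^ n = 2 ^ n * √x ^ n := mul_pow _ _ _
      _ ≤ ((n + 1) * n.choose (n / 2)) * ((1 + √x) * x ^ (n / 2)) := by gcongr
      _ = _ := by ring

/-! ### Rates of the power sums and of the largest atom -/

theorem tsum_convPow_freeSRW {d : ℕ} (hd : 2 ≤ d) (n : ℕ) {F : ℝ → ℝ} (hF : F 0 = 0) :
    ∑' ω, F (convPow (freeSRW d hd) n ω).toReal =
      ∑ k ∈ Finset.range (n + 1), (sphere d k).card * F (walkCount d n k / (2 * d : ℝ) ^ n) := by
  classical
  rw [tsum_eq_sum (s := (Finset.range (n + 1)).biUnion (sphere d)), Finset.sum_biUnion]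
  · refine Finset.sum_congr rfl fun k _ => ?_
    rw [Finset.sum_congr rfl fun ω hω => by rw [toReal_convPow_freeSRW, mem_sphere.1 hω],
      Finset.sum_const, nsmul_eq_mul]
  · intro i _ j _ hij
    refine Finset.disjoint_left.2 fun x hx hx' => hij ?_
    rw [← mem_sphere.1 hx, mem_sphere.1 hx']
  · intro ω hω
    have : n < ω.norm := by simpa using hω
    rw [toReal_convPow_freeSRW, walkCount_eq_zero this]
    simpa using hF

theorem cast_branching {d : ℕ} (hd : 2 ≤ d) : (((2 * d - 1 : ℕ) : ℝ)) = 2 * d - 1 := by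
  rw [Nat.cast_sub (by omega)]
  simp

theorem one_lt_branching {d : ℕ} (hd : 2 ≤ d) : (1 : ℝ) < 2 * d - 1 := by
  have : (2 : ℝ) ≤ d := by exact_mod_cast hd
  linarith

theorem walkCount_le_real {d : ℕ} (hd : 2 ≤ d) {n v k : ℕ} (h : n = 2 * v + k) :
    (walkCount d n k : ℝ) ≤ (2 * d - 1 : ℝ) ^ v * n.choose v := by
  rw [← cast_branching hd]
  exact_mod_cast walkCount_le hd h

theorem le_walkCount_real {d : ℕ} (hd : 2 ≤ d) {n v k : ℕ} (h : n = 2 * v + k) :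
    (2 * d - 1 : ℝ) ^ v * n.choose v ≤ (n + 1) * walkCount d n k := by
  rw [← cast_branching hd]
  exact_mod_cast le_walkCount hd h

theorem pow_le_card_sphere_real {d : ℕ} (hd : 2 ≤ d) (k : ℕ) : (2 * d - 1 : ℝ) ^ k ≤ (sphere d k).card := by
  rw [← cast_branching hd]
  exact_mod_cast pow_le_card_sphere hd k

theorem card_sphere_le_real {d : ℕ} (hd : 2 ≤ d) (k : ℕ) : ((sphere d k).card : ℝ) ≤ 2 * (2 * d - 1 : ℝ) ^ k := by
  rw [← cast_branching hd]
  exact_mod_cast card_sphere_le hd k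

/-- The weight `q ^ ((α - 2) / α)` of a downward step, where `q = 2 d - 1`. -/
noncomputable def stepWeight (d : ℕ) (α : ℝ) : ℝ := (2 * d - 1 : ℝ) ^ ((α - 2) / α)

theorem stepWeight_pos {d : ℕ} (hd : 2 ≤ d) (α : ℝ) : 0 < stepWeight d α :=
  Real.rpow_pos_of_pos (by linarith [one_lt_branching hd]) _

/-- As k = n - 2v, one has q^k q^(αv) = q^n q^((α-2)v): the sphere size and the mass combine into
one weight per downward step, whose α-th power is q^(α-2). -/
theorem pow_mul_rpow_eq {d : ℕ} (hd : 2 ≤ d) {α : ℝ} (hα : 0 < α) {n v k : ℕ}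
    (h : n = 2 * v + k) {c : ℝ} (hc : 0 ≤ c) :
    (2 * d - 1 : ℝ) ^ k * ((2 * d - 1 : ℝ) ^ v * c) ^ α =
      (2 * d - 1 : ℝ) ^ n * (c * stepWeight d α ^ v) ^ α := by
  have hq : (0 : ℝ) < 2 * d - 1 := by linarith [one_lt_branching hd]
  have hw := stepWeight_pos hd α
  rw [Real.mul_rpow (by positivity) hc, Real.mul_rpow hc (by positivity), stepWeight]
  generalize (2 * d - 1 : ℝ) = q at *
  have e : q ^ k * (q ^ v) ^ α = q ^ n * ((q ^ ((α - 2) / α)) ^ v) ^ α := by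
    rw [← Real.rpow_natCast q k, ← Real.rpow_natCast q v, ← Real.rpow_natCast q n,
      ← Real.rpow_natCast (q ^ _) v, ← Real.rpow_mul hq.le, ← Real.rpow_mul hq.le,
      ← Real.rpow_mul hq.le, ← Real.rpow_add hq, ← Real.rpow_add hq, h]
    congr 1
    push_cast
    field_simp
    ring
  linear_combination c ^ α * e

/-- The exponential rate of `∑ ω, μ^{(n)}(ω) ^ α`. -/
noncomputable def powerSumRate (d : ℕ) (α : ℝ) : ℝ :=
  (2 * d - 1) * (growth (stepWeight d α) / (2 * d)) ^ α

theorem powerSumRate_pos {d : ℕ} (hd : 2 ≤ d) (α : ℝ) : 0 < powerSumRate d α := by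
  have hq := one_lt_branching hd
  have := growth_pos (stepWeight_pos hd α)
  unfold powerSumRate
  have h1 : (0 : ℝ) < 2 * d - 1 := by linarith
  have h2 : (0 : ℝ) < d := by linarith
  positivity

theorem powerSumRate_pow {d : ℕ} (hd : 2 ≤ d) (α : ℝ) (n : ℕ) :
    powerSumRate d α ^ n =
      (2 * d - 1) ^ n * ((growth (stepWeight d α)) ^ n / (2 * d : ℝ) ^ n) ^ α := by
  have := growth_pos (stepWeight_pos hd α)
  rw [powerSumRate, mul_pow, ← div_pow, ← Real.rpow_natCast (_ ^ α), ← Real.rpow_mul (by positivity),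
    mul_comm α, Real.rpow_mul (by positivity), Real.rpow_natCast]

theorem tsum_rpow_le {d : ℕ} (hd : 2 ≤ d) {α : ℝ} (hα : 0 < α) (n : ℕ) :
    ∑' ω, (convPow (freeSRW d hd) n ω).toReal ^ α ≤ 2 * (n + 1) * powerSumRate d α ^ n := by
  have hρ := powerSumRate_pos hd α
  have hq : (0 : ℝ) < 2 * d - 1 := by linarith [one_lt_branching hd]
  have hw := stepWeight_pos hd α
  rw [tsum_convPow_freeSRW hd n (F := fun t => t ^ α) (Real.zero_rpow hα.ne')]
  calc _ ≤ ∑ k ∈ Finset.range (n + 1), 2 * powerSumRate d α ^ n := by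
        refine Finset.sum_le_sum fun k hk => ?_
        have hk : k ≤ n := by simpa [Nat.lt_succ_iff] using hk
        rcases Nat.even_or_odd (n + k) with he | ho
        · obtain ⟨v, hv⟩ : ∃ v, n = 2 * v + k := by
            obtain ⟨r, hr⟩ := he
            exact ⟨r - k, by omega⟩
          calc _ ≤ (2 * (2 * d - 1 : ℝ) ^ k) *
                (((2 * d - 1 : ℝ) ^ v * n.choose v) / (2 * d : ℝ) ^ n) ^ α := by
                gcongr
                · exact card_sphere_le_real hd k
                · exact walkCount_le_real hd hv
            _ = 2 * ((2 * d - 1 : ℝ) ^ n *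
                ((n.choose v * stepWeight d α ^ v) / (2 * d : ℝ) ^ n) ^ α) := by
                rw [Real.div_rpow (by positivity) (by positivity),
                  Real.div_rpow (by positivity) (by positivity), mul_div_assoc', mul_div_assoc',
                  mul_assoc, pow_mul_rpow_eq hd hα hv (by positivity)]
                ring
            _ ≤ _ := by
                rw [powerSumRate_pow hd]
                gcongr
                exact choose_mul_pow_le_growth hw (by omega)
        · rw [walkCount_eq_zero_of_odd ho]
          simp only [Nat.cast_zero, zero_div, Real.zero_rpow hα.ne', mul_zero]
          positivity
    _ = _ := by
        rw [Finset.sum_const, Finset.card_range, nsmul_eq_mul]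
        push_cast
        ring

/-- Only the sphere of the near-optimal v is kept. The exponent 2α collects one factor n + 1 from
the choice of v and one from the ballot bound, each raised to α. -/
theorem le_tsum_rpow {d : ℕ} (hd : 2 ≤ d) {α : ℝ} (hα : 0 < α) (n : ℕ) :
    powerSumRate d α ^ n ≤ (1 + √(stepWeight d α)) ^ α * ((n : ℝ) + 1) ^ (2 * α) *
      ∑' ω, (convPow (freeSRW d hd) n ω).toReal ^ α := by
  have hq : (0 : ℝ) < 2 * d - 1 := by linarith [one_lt_branching hd]
  have hw := stepWeight_pos hd α
  have hg := growth_pos hw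
  obtain ⟨v, hv, hle⟩ := exists_growth_pow_le hw n
  obtain ⟨k, hk⟩ : ∃ k, n = 2 * v + k := ⟨n - 2 * v, by omega⟩
  have hterm : (2 * d - 1 : ℝ) ^ k * (walkCount d n k / (2 * d : ℝ) ^ n) ^ α ≤
      ∑' ω, (convPow (freeSRW d hd) n ω).toReal ^ α := by
    rw [tsum_convPow_freeSRW hd n (F := fun t => t ^ α) (Real.zero_rpow hα.ne')]
    refine le_trans ?_ (Finset.single_le_sum (f := fun k => ((sphere d k).card : ℝ) *
      (walkCount d n k / (2 * d : ℝ) ^ n) ^ α) (fun k _ => by positivity)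
      (Finset.mem_range.2 (show k < n + 1 by omega)))
    gcongr
    exact pow_le_card_sphere_real hd k
  calc powerSumRate d α ^ n
      ≤ (2 * d - 1) ^ n * (((1 + √(stepWeight d α)) * (n + 1) *
          (n.choose v * stepWeight d α ^ v)) / (2 * d : ℝ) ^ n) ^ α := by
        rw [powerSumRate_pow hd]
        gcongr
    _ = (1 + √(stepWeight d α)) ^ α * ((n : ℝ) + 1) ^ α * ((2 * d - 1 : ℝ) ^ k *
          (((2 * d - 1 : ℝ) ^ v * n.choose v) / (2 * d : ℝ) ^ n) ^ α) := by
        rw [Real.div_rpow (by positivity) (by positivity),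
          Real.div_rpow (by positivity) (by positivity), mul_div_assoc', mul_div_assoc',
          pow_mul_rpow_eq hd hα hk (by positivity), Real.mul_rpow (by positivity) (by positivity),
          Real.mul_rpow (by positivity) (by positivity)]
        ring
    _ ≤ (1 + √(stepWeight d α)) ^ α * ((n : ℝ) + 1) ^ α * ((2 * d - 1 : ℝ) ^ k *
          (((n + 1) * walkCount d n k) / (2 * d : ℝ) ^ n) ^ α) := by
        have := le_walkCount_real hd hk
        gcongr ?_ * (?_ * ?_)
        exact Real.rpow_le_rpow (by positivity) (by gcongr) hα.le
    _ = (1 + √(stepWeight d α)) ^ α * ((n : ℝ) + 1) ^ (2 * α) *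
          ((2 * d - 1 : ℝ) ^ k * (walkCount d n k / (2 * d : ℝ) ^ n) ^ α) := by
        rw [mul_div_assoc, Real.mul_rpow (by positivity) (by positivity), two_mul α,
          Real.rpow_add (by positivity)]
        ring
    _ ≤ _ := by gcongr

theorem tendsto_log_tsum_rpow {d : ℕ} (hd : 2 ≤ d) {α : ℝ} (hα : 0 < α) :
    Tendsto (fun n : ℕ => 1 / (n : ℝ) *
      Real.log (∑' ω, (convPow (freeSRW d hd) n ω).toReal ^ α)) atTop
      (𝓝 (Real.log (powerSumRate d α))) := by
  have hρ := powerSumRate_pos hd α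
  set K := (1 + √(stepWeight d α)) ^ α with hK
  have hKpos : 0 < K := by positivity
  -- These constants dominate both bounds: 2(n+1) above and K(n+1)^(2α) below.
  refine tendsto_log_div_of_le_mul_pow (C := 2 + K) (s := 1 + 2 * α) hρ (by positivity)
    (fun n => (tsum_rpow_le hd hα n).trans ?_) fun n => (le_tsum_rpow hd hα n).trans ?_
  · have h1 : ((n : ℝ) + 1) ≤ ((n : ℝ) + 1) ^ (1 + 2 * α) :=
      Real.self_le_rpow_of_one_le (by linarith [Nat.cast_nonneg (α := ℝ) n]) (by linarith)
    gcongr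
    linarith
  · have h0 : 0 ≤ ∑' ω, (convPow (freeSRW d hd) n ω).toReal ^ α :=
      tsum_nonneg fun ω => by positivity
    gcongr
    · linarith
    · linarith [Nat.cast_nonneg (α := ℝ) n]
    · linarith

/-- Sphere sizes play no role here, so the weight is x = q > 1 and the rate is 2√q/(2d). -/
theorem tendsto_log_iSup {d : ℕ} (hd : 2 ≤ d) :
    Tendsto (fun n : ℕ => 1 / (n : ℝ) *
      Real.log (⨆ ω, (convPow (freeSRW d hd) n ω).toReal)) atTop
      (𝓝 (Real.log (√(2 * d - 1) / d))) := by
  have hq := one_lt_branching hd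
  have hq0 : (0 : ℝ) < 2 * d - 1 := by linarith
  have hd0 : (0 : ℝ) < d := by linarith
  have hg : growth (2 * d - 1) / (2 * d) = √(2 * d - 1) / d := by
    rw [growth, if_neg (by linarith)]
    field_simp
  have hgpos := growth_pos hq0
  have hle : ∀ n ω, (convPow (freeSRW d hd) n ω).toReal ≤ (√(2 * d - 1) / d) ^ n := by
    intro n ω
    rw [toReal_convPow_freeSRW, ← hg, div_pow]
    gcongr
    rcases lt_or_ge n ω.norm with h | h
    · rw [walkCount_eq_zero h]
      simp only [Nat.cast_zero]
      positivity
    rcases Nat.even_or_odd (n + ω.norm) with he | ho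
    · obtain ⟨v, hv⟩ : ∃ v, n = 2 * v + ω.norm := by
        obtain ⟨r, hr⟩ := he
        exact ⟨r - ω.norm, by omega⟩
      refine (walkCount_le_real hd hv).trans ?_
      rw [mul_comm]
      exact choose_mul_pow_le_growth hq0 (by omega)
    · rw [walkCount_eq_zero_of_odd ho]
      simp only [Nat.cast_zero]
      positivity
  refine tendsto_log_div_of_le_mul_pow (C := 1 + √(2 * d - 1)) (s := 2) (by positivity)
    (by positivity) (fun n => ?_) fun n => ?_
  · refine (ciSup_le (hle n)).trans (le_mul_of_one_le_left (by positivity) ?_)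
    have h1 : 1 ≤ ((n : ℝ) + 1) ^ (2 : ℝ) :=
      Real.one_le_rpow (by linarith [Nat.cast_nonneg (α := ℝ) n]) (by norm_num)
    exact one_le_mul_of_one_le_of_one_le (by linarith [Real.sqrt_nonneg (2 * d - 1 : ℝ)]) h1
  · obtain ⟨v, hv, hgv⟩ := exists_growth_pow_le hq0 n
    obtain ⟨k, hk⟩ : ∃ k, n = 2 * v + k := ⟨n - 2 * v, by omega⟩
    have : Nonempty (Fin d) := ⟨⟨0, by omega⟩⟩
    obtain ⟨ω, hω⟩ := FreeGroup.norm_surjective (α := Fin d) k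
    have hsup : (walkCount d n k : ℝ) / (2 * d : ℝ) ^ n ≤
        ⨆ ω, (convPow (freeSRW d hd) n ω).toReal := by
      rw [← hω, ← toReal_convPow_freeSRW hd]
      exact le_ciSup ⟨_, Set.forall_mem_range.2 (hle n)⟩ ω
    refine le_trans ?_ (mul_le_mul_of_nonneg_left hsup (by positivity))
    rw [← hg, div_pow, mul_div_assoc']
    gcongr
    refine hgv.trans ?_
    rw [mul_comm (n.choose v : ℝ)]
    calc _ ≤ (1 + √(2 * d - 1)) * (n + 1 : ℝ) * ((n + 1) * walkCount d n k) := by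
          exact mul_le_mul_of_nonneg_left (le_walkCount_real hd hk) (by positivity)
      _ = _ := by
          rw [show ((n : ℝ) + 1) ^ (2 : ℝ) = ((n : ℝ) + 1) ^ 2 from Real.rpow_natCast _ 2]
          ring

/-! ### Rényi entropies and the Shannon case -/

theorem renyiEntropy_top {Ω : Type*} (ν : PMF Ω) :
    renyiEntropy ⊤ ν = -Real.log (⨆ ω, (ν ω).toReal) := by
  simp [renyiEntropy]

theorem renyiEntropy_one {Ω : Type*} (ν : PMF Ω) :
    renyiEntropy 1 ν = ∑' ω, (ν ω).toReal * Real.log (1 / (ν ω).toReal) := by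
  simp [renyiEntropy]

theorem renyiEntropy_ofReal {Ω : Type*} (ν : PMF Ω) {α : ℝ} (hα : 0 < α) (hα₁ : α ≠ 1) :
    renyiEntropy (ENNReal.ofReal α) ν =
      1 / (1 - α) * Real.log (∑' ω, (ν ω).toReal ^ α) := by
  rw [renyiEntropy, if_neg (by simpa using hα), if_neg (by simpa using hα₁),
    if_neg ENNReal.ofReal_ne_top, ENNReal.toReal_ofReal hα.le]

/-- Jensen's inequality between Shannon entropy and the power sums of a finitely supported
distribution. -/
theorem neg_mul_entropy_le_log_tsum_rpow {Ω : Type*} {ν : PMF Ω} (hν : ν.support.Finite) {t : ℝ}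
    (ht : -1 < t) :
    -t * ∑' ω, (ν ω).toReal * Real.log (1 / (ν ω).toReal) ≤
      Real.log (∑' ω, (ν ω).toReal ^ (1 + t)) := by
  set s := hν.toFinset with hs
  have hout : ∀ ω ∉ s, (ν ω).toReal = 0 := by
    intro ω hω
    have : ν ω = 0 := by simpa [hs] using hω
    simp [this]
  have hin : ∀ ω ∈ s, 0 < (ν ω).toReal := by
    intro ω hω
    have : ν ω ≠ 0 := by simpa [hs] using hω
    exact ENNReal.toReal_pos this (ν.apply_ne_top ω)
  have hsum : ∑ ω ∈ s, (ν ω).toReal = 1 := by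
    have h : ∑' ω, ν ω = ∑ ω ∈ s, ν ω := tsum_eq_sum fun ω hω => by simpa [hs] using hω
    rw [← ENNReal.toReal_sum fun ω _ => ν.apply_ne_top ω, ← h, ν.tsum_coe, ENNReal.toReal_one]
  have hne : s.Nonempty := by
    rw [Finset.nonempty_iff_ne_empty]
    intro h
    simp [h] at hsum
  rw [tsum_eq_sum (s := s) fun ω hω => by simp [hout ω hω],
    tsum_eq_sum (s := s) fun ω hω => by rw [hout ω hω, Real.zero_rpow (by linarith)]]
  set S := ∑ ω ∈ s, (ν ω).toReal ^ (1 + t) with hS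
  have hSpos : 0 < S := Finset.sum_pos (fun ω hω => Real.rpow_pos_of_pos (hin ω hω) _) hne
  -- Jensen by tangent line: log y ≤ y - 1 at y = w^t/S, weighted by w. The right-hand sides sum to
  -- 1 - 1 = 0.
  have key : ∀ ω ∈ s, -t * ((ν ω).toReal * Real.log (1 / (ν ω).toReal)) - (ν ω).toReal * Real.log S ≤
      (ν ω).toReal ^ (1 + t) / S - (ν ω).toReal := by
    intro ω hω
    have hw := hin ω hω
    generalize (ν ω).toReal = w at *
    have h1 := Real.log_le_sub_one_of_pos (show 0 < w ^ t / S by positivity)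
    rw [Real.log_div (by positivity) hSpos.ne', Real.log_rpow hw] at h1
    have h2 := mul_le_mul_of_nonneg_left h1 hw.le
    rw [Real.rpow_add hw, Real.rpow_one, one_div, Real.log_inv, mul_div_assoc]
    linarith
  have h := Finset.sum_le_sum key
  rw [Finset.sum_sub_distrib, Finset.sum_sub_distrib, ← Finset.mul_sum, ← Finset.sum_mul,
    ← Finset.sum_div, hsum, ← hS, div_self hSpos.ne'] at h
  linarith

theorem finite_support_convPow {d : ℕ} (hd : 2 ≤ d) (n : ℕ) :
    (convPow (freeSRW d hd) n).support.Finite := by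
  classical
  refine ((Finset.range (n + 1)).biUnion (sphere d)).finite_toSet.subset fun ω hω => ?_
  rw [PMF.mem_support_iff, convPow_freeSRW_apply] at hω
  have : ¬ n < ω.norm := fun h => hω (by simp [walkCount_eq_zero h])
  simpa using this

/-- Jensen bounds the entropy below for t > 0 and above for t < 0. Fixing t close to 0 before
letting n grow makes both bounds approach -m, so no uniformity in t is needed. -/
theorem tendsto_entropy_one {d : ℕ} (hd : 2 ≤ d) {m : ℝ}
    (h1 : Real.log (powerSumRate d 1) = 0)
    (hm : HasDerivAt (fun α => Real.log (powerSumRate d α)) m 1) :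
    Tendsto (fun n : ℕ => 1 / (n : ℝ) * renyiEntropy 1 (convPow (freeSRW d hd) n)) atTop
      (𝓝 (-m)) := by
  have hslope : Tendsto (fun t => t⁻¹ * Real.log (powerSumRate d (1 + t))) (𝓝[≠] 0) (𝓝 m) := by
    simpa [h1] using hasDerivAt_iff_tendsto_slope_zero.1 hm
  have hlim : ∀ {t : ℝ}, -1 < t → Tendsto (fun n : ℕ => -t⁻¹ * (1 / (n : ℝ) *
      Real.log (∑' ω, (convPow (freeSRW d hd) n ω).toReal ^ (1 + t)))) atTop
      (𝓝 (-t⁻¹ * Real.log (powerSumRate d (1 + t)))) := fun ht =>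
    (tendsto_log_tsum_rpow hd (by linarith)).const_mul _
  have hjensen : ∀ {t : ℝ}, -1 < t → ∀ n : ℕ,
      -t * (1 / (n : ℝ) * renyiEntropy 1 (convPow (freeSRW d hd) n)) ≤
      1 / (n : ℝ) * Real.log (∑' ω, (convPow (freeSRW d hd) n ω).toReal ^ (1 + t)) := by
    intro t ht n
    rw [renyiEntropy_one, mul_left_comm]
    exact mul_le_mul_of_nonneg_left
      (neg_mul_entropy_le_log_tsum_rpow (finite_support_convPow hd n) ht) (by positivity)
  rw [tendsto_order]
  constructor
  · intro b hb
    have hev : ∀ᶠ t in 𝓝[>] (0 : ℝ), t⁻¹ * Real.log (powerSumRate d (1 + t)) < -b :=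
      (hslope.mono_left (nhdsWithin_mono _ fun t ht => ne_of_gt ht)).eventually_lt_const (by linarith)
    obtain ⟨t, ht, ht0⟩ := (hev.and self_mem_nhdsWithin).exists
    have ht0 : 0 < t := ht0
    filter_upwards [(hlim (t := t) (by linarith)).eventually_const_lt
      (show b < -t⁻¹ * Real.log (powerSumRate d (1 + t)) by linarith)] with n hn
    refine hn.trans_le ?_
    have := mul_le_mul_of_nonneg_left (hjensen (t := t) (by linarith) n) (inv_pos.2 ht0).le
    rw [← mul_assoc, mul_neg, inv_mul_cancel₀ ht0.ne'] at this
    linarith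
  · intro b hb
    have hev : ∀ᶠ t in 𝓝[<] (0 : ℝ), -b < t⁻¹ * Real.log (powerSumRate d (1 + t)) :=
      (hslope.mono_left (nhdsWithin_mono _ fun t ht => ne_of_lt ht)).eventually_const_lt
        (by linarith)
    obtain ⟨t, ⟨ht, ht0⟩, ht1⟩ := ((hev.and self_mem_nhdsWithin).and
      (Ioo_mem_nhdsLT (show (-1 : ℝ) < 0 by norm_num))).exists
    have ht0 : t < 0 := ht0
    filter_upwards [(hlim (t := t) ht1.1).eventually_lt_const
      (show -t⁻¹ * Real.log (powerSumRate d (1 + t)) < b by linarith)] with n hn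
    refine lt_of_le_of_lt ?_ hn
    have := mul_le_mul_of_nonneg_left (hjensen (t := t) ht1.1 n) (neg_pos.2 (inv_lt_zero.2 ht0)).le
    rw [← mul_assoc, neg_mul_neg, inv_mul_cancel₀ ht0.ne] at this
    linarith

/-! ### Closed forms of the exponential rate -/

/-- The excess of the exponential rate of the power sums over its linear part, for `α ≤ 2`. -/
noncomputable def excess (L α : ℝ) : ℝ := α * Real.log (Real.cosh (L * (1 / 2 - 1 / α)))

/-- The derivative of `excess L`. -/
noncomputable def excessDeriv (L α : ℝ) : ℝ :=
  Real.log (Real.cosh (L * (1 / 2 - 1 / α))) +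
    L / α * (Real.sinh (L * (1 / 2 - 1 / α)) / Real.cosh (L * (1 / 2 - 1 / α)))

theorem hasDerivAt_exponent (L : ℝ) {α : ℝ} (hα : α ≠ 0) :
    HasDerivAt (fun α => L * (1 / 2 - 1 / α)) (L / α ^ 2) α := by
  have := ((hasDerivAt_inv hα).const_sub (1 / 2)).const_mul L
  simp only [one_div] at this ⊢
  exact this.congr_deriv (by rw [neg_neg, div_eq_mul_inv])

theorem hasDerivAt_excess (L : ℝ) {α : ℝ} (hα : α ≠ 0) :
    HasDerivAt (excess L) (excessDeriv L α) α := by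
  have h := (hasDerivAt_id α).mul
    ((hasDerivAt_exponent L hα).cosh.log (Real.cosh_pos _).ne')
  refine h.congr_deriv ?_
  have := (Real.cosh_pos (L * (1 / 2 - 1 / α))).ne'
  simp only [excessDeriv, id]
  field_simp

/-- Near 2, log cosh w is w²/2 to leading order and w has slope L/4, so the second derivative is
2(L/4)². -/
theorem hasDerivAt_excessDeriv_two (L : ℝ) : HasDerivAt (excessDeriv L) (L ^ 2 / 8) 2 := by
  have hw := hasDerivAt_exponent L (two_ne_zero (α := ℝ))
  have h := (hw.cosh.log (Real.cosh_pos _).ne').add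
    (((hasDerivAt_inv (two_ne_zero (α := ℝ))).const_mul L).mul
      (hw.sinh.div hw.cosh (Real.cosh_pos _).ne'))
  refine HasDerivAt.congr_deriv (f := excessDeriv L) h ?_
  norm_num
  ring

theorem excess_two (L : ℝ) : excess L 2 = 0 := by simp [excess]

theorem excessDeriv_two (L : ℝ) : excessDeriv L 2 = 0 := by simp [excessDeriv]

theorem analyticAt_excess (L : ℝ) {α : ℝ} (hα : α ≠ 0) : AnalyticAt ℝ (excess L) α := by
  have h1 : AnalyticAt ℝ (fun α : ℝ => L * (1 / 2 - 1 / α)) α :=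
    analyticAt_const.mul (analyticAt_const.sub (analyticAt_const.div analyticAt_id hα))
  have h2 : AnalyticAt ℝ (fun α : ℝ => Real.cosh (L * (1 / 2 - 1 / α))) α :=
    (Real.analyticAt_cosh).comp h1
  exact analyticAt_id.mul (h2.log (Real.cosh_pos _))

theorem stepWeight_eq_exp {d : ℕ} (hd : 2 ≤ d) {α : ℝ} (hα : 0 < α) :
    stepWeight d α = Real.exp (2 * (Real.log (2 * d - 1) * (1 / 2 - 1 / α))) := by
  rw [stepWeight, Real.rpow_def_of_pos (by linarith [one_lt_branching hd])]
  congr 1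
  field_simp

theorem log_powerSumRate {d : ℕ} (hd : 2 ≤ d) (α : ℝ) :
    Real.log (powerSumRate d α) = Real.log (2 * d - 1) +
      α * (Real.log (growth (stepWeight d α)) - Real.log (2 * d)) := by
  have hq := one_lt_branching hd
  have hg := growth_pos (stepWeight_pos hd α)
  have hd0 : (0 : ℝ) < d := by linarith
  rw [powerSumRate, Real.log_mul (by linarith) (by positivity), Real.log_rpow (by positivity),
    Real.log_div (by positivity) (by positivity)]

theorem stepWeight_le_one_iff {d : ℕ} (hd : 2 ≤ d) {α : ℝ} (hα : 0 < α) :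
    stepWeight d α ≤ 1 ↔ α ≤ 2 := by
  rw [stepWeight, Real.rpow_le_one_iff_of_pos (by linarith [one_lt_branching hd])]
  have hq := one_lt_branching hd
  rw [div_nonpos_iff]
  constructor
  · rintro (⟨_, h⟩ | ⟨h, _⟩)
    · rcases h with h | h <;> linarith
    · linarith
  · intro h
    exact Or.inl ⟨hq.le, Or.inr ⟨by linarith, hα.le⟩⟩

/-- In 1 + e^(2w) = 2 e^w cosh w, the factor e^w contributes αw = L(α/2 - 1), which cancels the
additive L and leaves α log √q; the cosh is the excess. -/
theorem log_powerSumRate_of_le_two {d : ℕ} (hd : 2 ≤ d) {α : ℝ} (hα : 0 < α) (hα₂ : α ≤ 2) :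
    Real.log (powerSumRate d α) =
      α * Real.log (√(2 * d - 1) / d) + excess (Real.log (2 * d - 1)) α := by
  have hq := one_lt_branching hd
  have hd0 : (0 : ℝ) < d := by linarith
  rw [log_powerSumRate hd, growth, if_pos ((stepWeight_le_one_iff hd hα).2 hα₂),
    stepWeight_eq_exp hd hα, excess]
  have hw : ∀ w : ℝ, 1 + Real.exp (2 * w) = 2 * Real.exp w * Real.cosh w := by
    intro w
    rw [Real.cosh_eq, Real.exp_neg, two_mul w, Real.exp_add]
    field_simp
    ring
  rw [hw, Real.log_mul (by positivity) (Real.cosh_pos _).ne', Real.log_mul (by norm_num)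
    (Real.exp_pos _).ne', Real.log_exp, Real.log_mul (by norm_num) hd0.ne',
    Real.log_div (Real.sqrt_ne_zero'.2 (by linarith)) hd0.ne', Real.log_sqrt (by linarith)]
  field_simp
  ring

theorem log_powerSumRate_of_two_le {d : ℕ} (hd : 2 ≤ d) {α : ℝ} (hα₂ : 2 ≤ α) :
    Real.log (powerSumRate d α) = α * Real.log (√(2 * d - 1) / d) := by
  rcases hα₂.eq_or_lt with rfl | hlt
  · rw [log_powerSumRate_of_le_two hd two_pos le_rfl, excess_two, add_zero]
  have hq := one_lt_branching hd
  have hd0 : (0 : ℝ) < d := by linarith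
  have hα : 0 < α := by linarith
  rw [log_powerSumRate hd, growth, if_neg (by rw [stepWeight_le_one_iff hd hα]; linarith),
    Real.log_mul (by norm_num) (Real.sqrt_ne_zero'.2 (stepWeight_pos hd α)),
    Real.log_sqrt (stepWeight_pos hd α).le, stepWeight_eq_exp hd hα, Real.log_exp,
    Real.log_mul (by norm_num) hd0.ne',
    Real.log_div (Real.sqrt_ne_zero'.2 (by linarith)) hd0.ne', Real.log_sqrt (by linarith)]
  field_simp
  ring

/-- Here p* = 1/(1+x) is the proportion of upward steps when a downward step has weight x. With y =
q^(2/α), everything reduces to logarithms of q, y and q + y. -/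
theorem freeRate_freeOpt {d : ℕ} (hd : 2 ≤ d) {α : ℝ} (hα : 0 < α) (hα₂ : α ≤ 2) :
    freeRate d α (freeOpt d α) = Real.log (powerSumRate d α) := by
  have hq := one_lt_branching hd
  have hd0 : (0 : ℝ) < d := by linarith
  rw [log_powerSumRate hd, growth, if_pos ((stepWeight_le_one_iff hd hα).2 hα₂), stepWeight,
    freeRate, freeOpt]
  have hx : (2 * d - 1 : ℝ) ^ ((α - 2) / α) = (2 * d - 1) / (2 * d - 1 : ℝ) ^ (2 / α) := by
    rw [sub_div, div_self hα.ne', Real.rpow_sub (by linarith), Real.rpow_one]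
  have hy : Real.log ((2 * d - 1 : ℝ) ^ (2 / α)) = 2 / α * Real.log (2 * d - 1) :=
    Real.log_rpow (by linarith) _
  have hypos : 0 < (2 * d - 1 : ℝ) ^ (2 / α) := Real.rpow_pos_of_pos (by linarith) _
  rw [hx]
  generalize (2 * d - 1 : ℝ) ^ (2 / α) = y at *
  generalize hqq : (2 * d - 1 : ℝ) = q at *
  have hq0 : 0 < q := by linarith
  have h1 : 1 - y / (q + y) = q / (q + y) := by field_simp; ring
  have h2 : 1 + q / y = (q + y) / y := by field_simp; ring
  rw [Real.binEntropy, h1, h2, Real.log_inv, Real.log_inv, Real.log_div hypos.ne' (by positivity),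
    Real.log_div hq0.ne' (by positivity), Real.log_div (by positivity) hypos.ne', hy]
  have hs : q + y ≠ 0 := by positivity
  field_simp
  ring

theorem log_powerSumRate_one {d : ℕ} (hd : 2 ≤ d) : Real.log (powerSumRate d 1) = 0 := by
  have hq := one_lt_branching hd
  have hd0 : (0 : ℝ) < d := by linarith
  have hx : stepWeight d 1 = (2 * d - 1 : ℝ)⁻¹ := by
    rw [stepWeight, ← Real.rpow_neg_one]
    norm_num
  have h1 : powerSumRate d 1 = 1 := by
    rw [powerSumRate, growth, if_pos ((stepWeight_le_one_iff hd one_pos).2 one_le_two), hx,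
      Real.rpow_one]
    have : (2 * d - 1 : ℝ) ≠ 0 := by linarith
    field_simp
    ring
  rw [h1, Real.log_one]

/-! ### Limits of the normalized entropies -/

theorem tendsto_renyiEntropy_top {d : ℕ} (hd : 2 ≤ d) :
    Tendsto (fun n : ℕ => 1 / (n : ℝ) * renyiEntropy ⊤ (convPow (freeSRW d hd) n)) atTop
      (𝓝 (-Real.log (√(2 * d - 1) / d))) := by
  simpa only [renyiEntropy_top, mul_neg] using (tendsto_log_iSup hd).neg

theorem tendsto_renyiEntropy_ofReal {d : ℕ} (hd : 2 ≤ d) {α : ℝ} (hα : 0 < α) (hα₁ : α ≠ 1) :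
    Tendsto (fun n : ℕ => 1 / (n : ℝ) *
      renyiEntropy (ENNReal.ofReal α) (convPow (freeSRW d hd) n)) atTop
      (𝓝 (1 / (1 - α) * Real.log (powerSumRate d α))) := by
  simp only [renyiEntropy_ofReal _ hα hα₁, mul_left_comm (1 / (_ : ℝ)) (1 / (1 - α))]
  exact (tendsto_log_tsum_rpow hd hα).const_mul _

/-- The exponential rate of the power sums, extended analytically from `(0, 2)` to `(0, ∞)`. -/
noncomputable def lowerRate (d : ℕ) (α : ℝ) : ℝ :=
  α * Real.log (√(2 * d - 1) / d) + excess (Real.log (2 * d - 1)) α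

theorem analyticAt_lowerRate (d : ℕ) {α : ℝ} (hα : α ≠ 0) : AnalyticAt ℝ (lowerRate d) α :=
  (analyticAt_id.mul analyticAt_const).add (analyticAt_excess _ hα)

theorem log_powerSumRate_eventuallyEq {d : ℕ} (hd : 2 ≤ d) {α : ℝ} (hα : 0 < α) (hα₂ : α < 2) :
    (fun α => Real.log (powerSumRate d α)) =ᶠ[𝓝 α] lowerRate d := by
  filter_upwards [Ioo_mem_nhds hα hα₂] with β hβ
  exact log_powerSumRate_of_le_two hd hβ.1 hβ.2.le

theorem lowerRate_one {d : ℕ} (hd : 2 ≤ d) : lowerRate d 1 = 0 := by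
  rw [← log_powerSumRate_one hd]
  exact (log_powerSumRate_of_le_two hd one_pos one_le_two).symm

theorem tendsto_renyiEntropy_one {d : ℕ} (hd : 2 ≤ d) :
    Tendsto (fun n : ℕ => 1 / (n : ℝ) * renyiEntropy 1 (convPow (freeSRW d hd) n)) atTop
      (𝓝 (-deriv (lowerRate d) 1)) :=
  tendsto_entropy_one hd (log_powerSumRate_one hd)
    ((analyticAt_lowerRate d one_ne_zero).differentiableAt.hasDerivAt.congr_of_eventuallyEq
      (log_powerSumRate_eventuallyEq hd one_pos one_lt_two))

theorem asymptoticRenyiEntropy_top {d : ℕ} (hd : 2 ≤ d) :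
    asymptoticRenyiEntropy ⊤ (freeSRW d hd) = -Real.log (√(2 * d - 1) / d) :=
  (tendsto_renyiEntropy_top hd).limUnder_eq

theorem freeEntropy_eq {d : ℕ} (hd : 2 ≤ d) {α : ℝ} (hα : 0 < α) (hα₁ : α ≠ 1) :
    freeEntropy d hd α = 1 / (1 - α) * Real.log (powerSumRate d α) :=
  (tendsto_renyiEntropy_ofReal hd hα hα₁).limUnder_eq

theorem freeEntropy_one {d : ℕ} (hd : 2 ≤ d) : freeEntropy d hd 1 = -deriv (lowerRate d) 1 := by
  rw [freeEntropy, ENNReal.ofReal_one]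
  exact (tendsto_renyiEntropy_one hd).limUnder_eq

theorem tendsto_asymptoticRenyiEntropy {d : ℕ} (hd : 2 ≤ d) {α : ℝ≥0∞} (hα : 0 < α) :
    Tendsto (fun n : ℕ => 1 / (n : ℝ) * renyiEntropy α (convPow (freeSRW d hd) n)) atTop
      (𝓝 (asymptoticRenyiEntropy α (freeSRW d hd))) := by
  refine tendsto_nhds_limUnder ?_
  rcases eq_or_ne α ⊤ with rfl | htop
  · exact ⟨_, tendsto_renyiEntropy_top hd⟩
  rcases eq_or_ne α 1 with rfl | hone
  · exact ⟨_, tendsto_renyiEntropy_one hd⟩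
  have h := tendsto_renyiEntropy_ofReal hd (ENNReal.toReal_pos hα.ne' htop)
    (fun h => hone (by rw [← ENNReal.ofReal_toReal htop, h, ENNReal.ofReal_one]))
  rw [ENNReal.ofReal_toReal htop] at h
  exact ⟨_, h⟩

/-! ### Analyticity away from 2 -/

/-- The log-rate vanishes at 1, so dividing by 1 - α gives minus its slope from 1; the Shannon limit
is exactly the value filling the gap at 1. -/
theorem freeEntropy_eq_neg_dslope {d : ℕ} (hd : 2 ≤ d) {α : ℝ} (hα : 0 < α) (hα₂ : α < 2) :
    freeEntropy d hd α = -dslope (lowerRate d) 1 α := by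
  rcases eq_or_ne α 1 with rfl | hα₁
  · rw [dslope_same, freeEntropy_one]
  · rw [dslope_of_ne _ hα₁, slope_def_field, lowerRate_one hd, sub_zero, freeEntropy_eq hd hα hα₁,
      ← div_neg, neg_sub, one_div_mul_eq_div]
    congr 1
    exact log_powerSumRate_of_le_two hd hα hα₂.le

theorem analyticAt_dslope {f : ℝ → ℝ} {a b : ℝ} (ha : AnalyticAt ℝ f a) (hb : AnalyticAt ℝ f b) :
    AnalyticAt ℝ (dslope f a) b := by
  rcases eq_or_ne b a with rfl | hne
  · obtain ⟨p, hp⟩ := ha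
    exact ⟨_, hp.has_fpower_series_dslope_fslope⟩
  · have h : AnalyticAt ℝ (fun x => (f x - f a) / (x - a)) b :=
      (hb.sub analyticAt_const).div (analyticAt_id.sub analyticAt_const) (sub_ne_zero.2 hne)
    refine h.congr ?_
    filter_upwards [isOpen_ne.mem_nhds hne] with x hx
    rw [dslope_of_ne _ hx, slope_def_field]

theorem analyticOnNhd_freeEntropy {d : ℕ} (hd : 2 ≤ d) :
    AnalyticOnNhd ℝ (freeEntropy d hd) (Set.Ioi 0 \ {2}) := by
  rintro α ⟨hα, hα₂⟩
  have hα : 0 < α := hα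
  rcases lt_or_gt_of_ne (show α ≠ 2 from hα₂) with hlt | hgt
  · refine (analyticAt_dslope (analyticAt_lowerRate d one_ne_zero)
      (analyticAt_lowerRate d hα.ne')).neg.congr ?_
    filter_upwards [Ioo_mem_nhds hα hlt] with β hβ
    exact (freeEntropy_eq_neg_dslope hd hβ.1 hβ.2).symm
  · have h : AnalyticAt ℝ (fun β : ℝ => 1 / (1 - β) * (β * Real.log (√(2 * d - 1) / d))) α :=
      (analyticAt_const.div (analyticAt_const.sub analyticAt_id)
        (show 1 - α ≠ 0 by linarith)).mul (analyticAt_id.mul analyticAt_const)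
    refine h.congr ?_
    filter_upwards [Ioi_mem_nhds hgt] with β hβ
    have hβ : 2 < β := hβ
    rw [freeEntropy_eq hd (by linarith) (by linarith), log_powerSumRate_of_two_le hd hβ.le]

/-! ### Regularity at 2 -/

/-- `excess L` on `(-∞, 2]`, extended by zero. -/
noncomputable def truncatedExcess (L α : ℝ) : ℝ := if α ≤ 2 then excess L α else 0

theorem log_powerSumRate_eq_add_truncatedExcess {d : ℕ} (hd : 2 ≤ d) {α : ℝ} (hα : 0 < α) :
    Real.log (powerSumRate d α) =
      α * Real.log (√(2 * d - 1) / d) + truncatedExcess (Real.log (2 * d - 1)) α := by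
  unfold truncatedExcess
  split_ifs with h
  · exact log_powerSumRate_of_le_two hd hα h
  · rw [log_powerSumRate_of_two_le hd (by linarith), add_zero]

theorem hasDerivAt_truncatedExcess (L : ℝ) {α : ℝ} (hα : 0 < α) :
    HasDerivAt (truncatedExcess L) (if α ≤ 2 then excessDeriv L α else 0) α := by
  rcases lt_trichotomy α 2 with hlt | rfl | hgt
  · rw [if_pos hlt.le]
    refine (hasDerivAt_excess L hα.ne').congr_of_eventuallyEq ?_
    filter_upwards [Iio_mem_nhds hlt] with β hβ
    exact if_pos (le_of_lt hβ)
  · rw [if_pos le_rfl]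
    have h1 : HasDerivWithinAt (truncatedExcess L) (excessDeriv L 2) (Set.Iic 2) 2 :=
      (hasDerivAt_excess L two_ne_zero).hasDerivWithinAt.congr (fun β hβ => if_pos hβ)
        (if_pos le_rfl)
    have h2 : HasDerivWithinAt (truncatedExcess L) (excessDeriv L 2) (Set.Ici 2) 2 := by
      rw [excessDeriv_two]
      refine (hasDerivWithinAt_const 2 _ 0).congr (fun β hβ => ?_) (by
        simp [truncatedExcess, excess_two])
      rcases (show 2 ≤ β from hβ).eq_or_lt with rfl | hlt
      · simp [truncatedExcess, excess_two]
      · exact if_neg (not_le.2 hlt)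
    have h3 := h1.union h2
    rwa [Set.Iic_union_Ici, hasDerivWithinAt_univ] at h3
  · rw [if_neg (not_le.2 hgt)]
    refine (hasDerivAt_const α 0).congr_of_eventuallyEq ?_
    filter_upwards [Ioi_mem_nhds hgt] with β hβ
    exact if_neg (not_le.2 hβ)

theorem not_differentiableAt_deriv_truncatedExcess {L : ℝ} (hL : L ≠ 0) :
    ¬ DifferentiableAt ℝ (deriv (truncatedExcess L)) 2 := by
  intro h
  -- The set is `Set.Ioc 0 2`, not `Set.Iic 2`, because the derivative formula is available only for
  -- positive arguments.
  have hleft : HasDerivWithinAt (deriv (truncatedExcess L)) (L ^ 2 / 8) (Set.Ioc 0 2) 2 := by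
    refine (hasDerivAt_excessDeriv_two L).hasDerivWithinAt.congr (fun β hβ => ?_) ?_
    · rw [(hasDerivAt_truncatedExcess L hβ.1).deriv, if_pos hβ.2]
    · rw [(hasDerivAt_truncatedExcess L two_pos).deriv, if_pos le_rfl]
  have hright : HasDerivWithinAt (deriv (truncatedExcess L)) 0 (Set.Ici 2) 2 := by
    have hz : ∀ β ∈ Set.Ici (2 : ℝ), deriv (truncatedExcess L) β = 0 := by
      intro β hβ
      have hβ : 2 ≤ β := hβ
      rw [(hasDerivAt_truncatedExcess L (by linarith)).deriv]
      rcases hβ.eq_or_lt with rfl | hlt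
      · rw [if_pos le_rfl, excessDeriv_two]
      · rw [if_neg (not_le.2 hlt)]
    exact (hasDerivWithinAt_const 2 _ 0).congr hz (hz 2 Set.self_mem_Ici)
  have e1 := (uniqueDiffOn_Ioc (0 : ℝ) 2 2 ⟨two_pos, le_rfl⟩).eq_deriv _ hleft
    h.hasDerivAt.hasDerivWithinAt
  have e2 := (uniqueDiffOn_Ici (2 : ℝ) 2 Set.self_mem_Ici).eq_deriv _ hright
    h.hasDerivAt.hasDerivWithinAt
  have : L ^ 2 / 8 = 0 := e1.trans e2.symm
  have : L ^ 2 = 0 := by linarith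
  exact hL (pow_eq_zero_iff two_ne_zero |>.1 this)

theorem differentiableAt_freeEntropy_two {d : ℕ} (hd : 2 ≤ d) :
    DifferentiableAt ℝ (freeEntropy d hd) 2 := by
  have h : DifferentiableAt ℝ (fun α : ℝ => 1 / (1 - α) * (α * Real.log (√(2 * d - 1) / d) +
      truncatedExcess (Real.log (2 * d - 1)) α)) 2 :=
    ((differentiableAt_const _).div ((differentiableAt_const _).sub differentiableAt_id)
      (by norm_num)).mul ((differentiableAt_id.mul (differentiableAt_const _)).add
        (hasDerivAt_truncatedExcess _ two_pos).differentiableAt)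
  refine h.congr_of_eventuallyEq ?_
  filter_upwards [Ioi_mem_nhds (show (1 : ℝ) < 2 by norm_num)] with α hα
  have hα : 1 < α := hα
  rw [freeEntropy_eq hd (by linarith) (by linarith),
    log_powerSumRate_eq_add_truncatedExcess hd (by linarith)]

/-- The truncated excess is (1-α) times the entropy minus a linear term, so a second derivative of
the entropy at 2 would give one of the truncated excess, whose one-sided values L²/8 and 0 differ.
-/
theorem not_differentiableAt_deriv_freeEntropy {d : ℕ} (hd : 2 ≤ d) :
    ¬ DifferentiableAt ℝ (deriv (freeEntropy d hd)) 2 := by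
  intro h
  refine not_differentiableAt_deriv_truncatedExcess
    (Real.log_pos (one_lt_branching hd)).ne' ?_
  have hdiff : ∀ α : ℝ, 1 < α → DifferentiableAt ℝ (freeEntropy d hd) α := by
    intro α hα
    rcases eq_or_ne α 2 with rfl | hne
    · exact differentiableAt_freeEntropy_two hd
    · exact (analyticOnNhd_freeEntropy hd α
        ⟨show (0 : ℝ) < α by linarith, hne⟩).differentiableAt
  have heq : ∀ α : ℝ, 1 < α → truncatedExcess (Real.log (2 * d - 1)) α =
      (1 - α) * freeEntropy d hd α - α * Real.log (√(2 * d - 1) / d) := by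
    intro α hα
    have h1 : 1 - α ≠ 0 := by linarith
    rw [freeEntropy_eq hd (by linarith) (by linarith),
      log_powerSumRate_eq_add_truncatedExcess hd (by linarith)]
    field_simp
    ring
  have hderiv : ∀ α : ℝ, 1 < α → deriv (truncatedExcess (Real.log (2 * d - 1))) α =
      -freeEntropy d hd α + (1 - α) * deriv (freeEntropy d hd) α -
        Real.log (√(2 * d - 1) / d) := by
    intro α hα
    have h1 : HasDerivAt (fun α => (1 - α) * freeEntropy d hd α -
        α * Real.log (√(2 * d - 1) / d)) _ α :=
      (((hasDerivAt_id α).const_sub 1).mul (hdiff α hα).hasDerivAt).sub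
        ((hasDerivAt_id α).mul_const _)
    have h2 := h1.congr_of_eventuallyEq (f₁ := truncatedExcess (Real.log (2 * d - 1))) (by
      filter_upwards [Ioi_mem_nhds hα] with β hβ
      exact heq β hβ)
    rw [h2.deriv]
    simp
  have h3 : DifferentiableAt ℝ (fun α => -freeEntropy d hd α +
      (1 - α) * deriv (freeEntropy d hd) α - Real.log (√(2 * d - 1) / d)) 2 :=
    ((hdiff 2 one_lt_two).neg.add (((differentiableAt_const _).sub differentiableAt_id).mul h)).sub
      (differentiableAt_const _)
  refine h3.congr_of_eventuallyEq ?_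
  filter_upwards [Ioi_mem_nhds (show (1 : ℝ) < 2 by norm_num)] with α hα
  exact hderiv α hα

end RenyiWalk

theorem mainTheorem2 (d : ℕ) (hd : 2 ≤ d) :
    -- the limit defining the asymptotic entropy exists for every order in `(0, ∞]`
    (∀ α : ℝ≥0∞, 0 < α →
      Tendsto
        (fun n : ℕ => 1 / (n : ℝ) *
          RenyiWalk.renyiEntropy α (RenyiWalk.convPow (RenyiWalk.freeSRW d hd) n))
        atTop (𝓝 (RenyiWalk.asymptoticRenyiEntropy α (RenyiWalk.freeSRW d hd)))) ∧
    -- analyticity on `(0, ∞) \ {2}`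
    AnalyticOnNhd ℝ (RenyiWalk.freeEntropy d hd) (Set.Ioi 0 \ {2}) ∧
    -- at `2`: not analytic; differentiable once but not twice
    ¬ AnalyticAt ℝ (RenyiWalk.freeEntropy d hd) 2 ∧
    DifferentiableAt ℝ (RenyiWalk.freeEntropy d hd) 2 ∧
    ¬ DifferentiableAt ℝ (deriv (RenyiWalk.freeEntropy d hd)) 2 ∧
    -- the explicit formula below `2`
    (∀ α : ℝ, 0 < α → α < 2 → α ≠ 1 →
      RenyiWalk.freeEntropy d hd α =
        1 / (1 - α) * RenyiWalk.freeRate d α (RenyiWalk.freeOpt d α)) ∧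
    -- the form of the entropy from `2` on
    (∀ α : ℝ, 2 ≤ α →
      RenyiWalk.freeEntropy d hd α =
        α / (α - 1) * RenyiWalk.asymptoticRenyiEntropy ⊤ (RenyiWalk.freeSRW d hd)) := by
  open RenyiWalk in
  refine ⟨fun α hα => tendsto_asymptoticRenyiEntropy hd hα, analyticOnNhd_freeEntropy hd,
    fun h => not_differentiableAt_deriv_freeEntropy hd h.deriv.differentiableAt,
    differentiableAt_freeEntropy_two hd, not_differentiableAt_deriv_freeEntropy hd,
    fun α hα hα₂ hα₁ => ?_, fun α hα => ?_⟩
  · rw [freeEntropy_eq hd hα hα₁, freeRate_freeOpt hd hα hα₂.le]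
  · rw [freeEntropy_eq hd (by linarith) (by linarith), log_powerSumRate_of_two_le hd hα,
      asymptoticRenyiEntropy_top]
    have h1 : 1 - α ≠ 0 := by linarith
    have h2 : α - 1 ≠ 0 := by linarith
    field_simp
    ring
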